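/- Let $\mathscr{O}$ be a set of type variables and let $\mathscr{V}$ be a countably infinite set of term variables. Terms are the finite pure $\lambda$-terms over $\mathscr{V}$, modulo $\alpha$-equivalence. The order of a term $t$ is $\sup\{n\in\mathbb{N} \mid \exists x_1,\ldots,x_n,u,\ t\to_\beta^* \lambda x_1\ldots\lambda x_n.u\}\in\mathbb{N}\cup\{\infty\}$, and $t$ is a zero term if its order is $0$ (i.e. $t$ does not reduce to an abstraction). System $\mathtt{S}$ is defined as follows. Its types are given by the coinductive (possibly infinite) grammar $T, S_k ::= o \mid F\to T$ with $o\in\mathscr{O}$, where a sequence type $F=(k\cdot S_k)_{k\in K}$ is a family of types indexed by an arbitrary set of tracks $K\subseteq\mathbb{N}\setminus\{0,1\}$. A context $C$ is a total function from $\mathscr{V}$ to sequence types; $x:F$ denotes the context that maps $x$ to $F$ and all other variables to the empty sequence type $()$, and $C;x:F$ (where $C(x)=()$) is the context that maps $x$ to $F$ and agrees with $C$ elsewhere. A union $\uplus$ of sequence types is defined only when their index sets are pairwise disjoint (no track conflict), and it is extended pointwise to contexts. Derivations are generated inductively by the following rules: - (ax) $x:(k\cdot T)\vdash x:T$, for every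 variable $x$, track $k\geq 2$ and type $T$; - (abs) from $C;x:F\vdash t:T$ infer $C\vdash\lambda x.t:F\to T$; - (app) from $C\vdash t:(k\cdot S_k)_{k\in K}\to T$ and $D_k\vdash u:S_k$ for all $k\in K$ infer $C\uplus(\biguplus_{k\in K}D_k)\vdash t\,u:T$, provided that there is no track conflict in this union of contexts. Then, for every zero term $t$ and every type variable $o\in\mathscr{O}$, there is a context $C$ such that $C\vdash t:o$ is derivable in system $\mathtt{S}$. -/

import Mathlib

namespace InfTyping

/-! ## Pure lambda-terms up to alpha-equivalence, and their order -/

/-- Finite pure `λ`-terms modulo `α`-equivalence, in de Bruijn representation. The free variables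
are numbered by natural numbers: the index `n` under `d` abstractions is bound if `n < d`, and is
the free variable number `n - d` otherwise. -/
inductive Term : Type
  | var (n : ℕ) : Term
  | lam (t : Term) : Term
  | app (t u : Term) : Term

namespace Term

/-- Extension of a renaming of variables under an abstraction. -/
def upRen (ρ : ℕ → ℕ) : ℕ → ℕ
  | 0 => 0
  | n + 1 => ρ n + 1

/-- Renaming of the free variables. -/
def rename : (ℕ → ℕ) → Term → Term
  | ρ, var n => var (ρ n)
  | ρ, lam t => lam (rename (upRen ρ) t)
  | ρ, app t u => app (rename ρ t) (rename ρ u)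

/-- Extension of a substitution under an abstraction. -/
def upSubst (σ : ℕ → Term) : ℕ → Term
  | 0 => var 0
  | n + 1 => rename Nat.succ (σ n)

/-- Capture-avoiding parallel substitution. -/
def subst : (ℕ → Term) → Term → Term
  | σ, var n => σ n
  | σ, lam t => lam (subst (upSubst σ) t)
  | σ, app t u => app (subst σ t) (subst σ u)

/-- The substitution that replaces the variable `0` by `u` and lowers the other ones. -/
def single (u : Term) : ℕ → Term
  | 0 => u
  | n + 1 => var n

/-- One step of `β`-reduction, at any position: the contextual closure of `(λx.t) u → t[u/x]`. -/
inductive Beta : Term → Term → Prop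
  | beta (t u : Term) : Beta (app (lam t) u) (subst (single u) t)
  | lam {t t' : Term} : Beta t t' → Beta (lam t) (lam t')
  | appL {t t' : Term} (u : Term) : Beta t t' → Beta (app t u) (app t' u)
  | appR (t : Term) {u u' : Term} : Beta u u' → Beta (app t u) (app t u')

/-- `β`-reduction in finitely many (possibly zero) steps. -/
def BetaStar : Term → Term → Prop := Relation.ReflTransGen Beta

/-- `lams n u` is `λx₁ … λxₙ. u`. -/
def lams : ℕ → Term → Term
  | 0, u => u
  | n + 1, u => lam (lams n u)

/-- The order of `t`: the supremum in `ℕ ∪ {∞}` of all `n` such that `t` reduces to a term of the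
form `λx₁ … λxₙ. u`. -/
noncomputable def order (t : Term) : ℕ∞ :=
  sSup {m : ℕ∞ | ∃ n : ℕ, m = n ∧ ∃ u : Term, BetaStar t (lams n u)}

/-- Zero terms: terms of order `0`. -/
def IsZeroTerm (t : Term) : Prop := order t = 0

end Term

/-! ## The types of system `S` -/

/-- Labels of the nodes of a type: a type variable (from the set `O`) or an arrow. -/
inductive Node (O : Type*) : Type _
  | var (o : O) : Node O
  | arrow : Node O

/-- The types of system `S`, given by the coinductive grammar `T ::= o | (k · S_k)_{k ∈ K} → T`
with `K ⊆ ℕ \ {0, 1}` arbitrary. The coinductively generated types are the possibly infinite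
labelled trees whose positions are words of natural numbers (read from the root): a node labelled
with a type variable is a leaf, a node labelled with `→` has its target as child on track `1` and
its sources as children on some set of tracks `k ≥ 2`. `label c = none` means that `c` is not a
position of the tree. -/
@[ext]
structure SType (O : Type*) where
  /-- The label at a position; `none` outside the support. -/
  label : List ℕ → Option (Node O)
  /-- The tree has a root. -/
  root : label [] ≠ none
  /-- Only arrow nodes have children, and these are on tracks `≥ 1`. -/
  parent : ∀ (c : List ℕ) (k : ℕ),
    label (c ++ [k]) ≠ none → label c = some Node.arrow ∧ 1 ≤ k
  /-- Every arrow node has a target. -/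
  target : ∀ c : List ℕ, label c = some Node.arrow → label (c ++ [1]) ≠ none

/-- Argument tracks: the natural numbers `k ≥ 2`. -/
abbrev Track : Type := {k : ℕ // 2 ≤ k}

/-- Sequence types `F = (k · S_k)_{k ∈ K}` with `K ⊆ ℕ \ {0, 1}`, as partial functions from tracks
to types; `F k = none` means `k ∉ K`. -/
abbrev SeqType (O : Type*) : Type _ := Track → Option (SType O)

variable {O : Type*}

namespace SeqType

/-- The empty sequence type `()`. -/
def empty : SeqType O := fun _ => none

/-- The sequence type `(k · T)` with one element. -/
def single (k : Track) (T : SType O) : SeqType O := fun j => if j = k then some T else none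

/-- The set `K` of roots of `(k · S_k)_{k ∈ K}`. -/
def roots (F : SeqType O) : Set Track := {k | (F k).isSome = true}

/-- The type `S_k` at a root `k`. -/
def get (F : SeqType O) (k : F.roots) : SType O := (F k.1).get k.2

end SeqType

namespace SType

/-- The type variable `o` as a type. -/
def var (o : O) : SType O where
  label
    | [] => some (Node.var o)
    | _ :: _ => none
  root := by simp
  parent c k h := by cases c <;> simp at h
  target c h := by cases c <;> simp at h

/-- The labelling of the tree of `F → T`. -/
def arrowLabel (F : SeqType O) (T : SType O) : List ℕ → Option (Node O)
  | [] => some Node.arrow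
  | k :: c =>
    if k = 1 then T.label c
    else if h : 2 ≤ k then (F ⟨k, h⟩).bind fun S => S.label c
    else none

/-- The arrow type `F → T`. -/
def arrow (F : SeqType O) (T : SType O) : SType O where
  label := arrowLabel F T
  root := by simp [arrowLabel]
  parent c k h := by
    cases c with
    | nil =>
      refine ⟨rfl, ?_⟩
      by_contra hk
      have : k = 0 := by omega
      subst this
      simp [arrowLabel] at h
    | cons j c =>
      simp only [List.cons_append, arrowLabel] at h ⊢
      split_ifs at h ⊢ with h1 h2
      · exact T.parent c k h
      · cases hF : F ⟨j, h2⟩ with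
        | none => simp [hF] at h
        | some S =>
          simp only [hF, Option.bind_some] at h ⊢
          exact S.parent c k h
      · exact absurd rfl h
  target c h := by
    cases c with
    | nil => simpa [arrowLabel] using T.root
    | cons j c =>
      simp only [List.cons_append, arrowLabel] at h ⊢
      split_ifs at h ⊢ with h1 h2
      · exact T.target c h
      · cases hF : F ⟨j, h2⟩ with
        | none => simp [hF] at h
        | some S =>
          simp only [hF, Option.bind_some] at h ⊢
          exact S.target c h

end SType

/-! ## Contexts, disjoint union and derivability in system `S` -/

/-- Contexts: total functions from the term variables to sequence types. -/
abbrev Ctx (O : Type*) : Type _ := ℕ → SeqType O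

namespace Ctx

/-- The context `x : F`, assigning `F` to the variable `x` and `()` to all the other ones. -/
def single (x : ℕ) (F : SeqType O) : Ctx O := fun y => if y = x then F else SeqType.empty

/-- The context `C; x : F`, where `x` is the variable bound by the next abstraction: `x` is the
index `0`, and the variable `n` outside the abstraction is the index `n + 1` inside. -/
def cons (F : SeqType O) (C : Ctx O) : Ctx O
  | 0 => F
  | n + 1 => C n

/-- `IsDisjUnion E U`: there is no track conflict between the contexts of the family `E`, and `U`
is their disjoint union `⊎ᵢ E i`. -/
def IsDisjUnion {ι : Type*} (E : ι → Ctx O) (U : Ctx O) : Prop :=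
  (∀ i j : ι, i ≠ j → ∀ (x : ℕ) (k : Track), E i x k = none ∨ E j x k = none) ∧
  ∀ (x : ℕ) (k : Track) (S : SType O), U x k = some S ↔ ∃ i, E i x k = some S

/-- The family consisting of `C` and of the contexts `D k`. -/
def family {ι : Type*} (C : Ctx O) (D : ι → Ctx O) : Option ι → Ctx O
  | none => C
  | some k => D k

end Ctx

/-- `Derivable C t T`: the judgment `C ⊢ t : T` is derivable in system `S`. Derivations are
inductively generated by the three rules; the application rule has one premise for the function
and one premise `D k ⊢ u : S_k` for every `k ∈ K` (there may be infinitely many). -/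
inductive Derivable : Ctx O → Term → SType O → Prop
  | ax (x : ℕ) (k : Track) (T : SType O) :
      Derivable (Ctx.single x (SeqType.single k T)) (Term.var x) T
  | abs {C : Ctx O} {F : SeqType O} {t : Term} {T : SType O} :
      Derivable (Ctx.cons F C) t T → Derivable C (Term.lam t) (SType.arrow F T)
  | app {C : Ctx O} {t u : Term} {F : SeqType O} {T : SType O} (D : F.roots → Ctx O) (U : Ctx O) :
      Derivable C t (SType.arrow F T) →
      (∀ k : F.roots, Derivable (D k) u (F.get k)) →
      Ctx.IsDisjUnion (Ctx.family C D) U →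
      Derivable U (Term.app t u) T

end InfTyping

/-! The run of Krivine's machine on `t` dictates the typing. On a zero term the machine never meets
an abstraction with an empty stack: it stops at a free head variable or runs forever. A term
evaluated at time `n` gets the type of its stack: each argument contributes a domain holding, on
track `m + 2`, the type of the stack at each time `m` when that argument is fetched, and the final
target is `o`. This description refers to itself, which coinductive types allow. At time 0 the stack
is empty, so `t` gets type `o`.

Tracks are times, and at most one variable is evaluated at each time. Evaluation times form a forest
in which siblings have disjoint descendants (`Desc.eq_of_siblings`), so the premises of an
application never conflict. The domain of an abstraction matches the context of its body because a
stamped closure is bound at most once (`Binds.unique`, `occurs_bound_iff`). `derivable_of_run`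
assembles the derivation by induction on the term. -/

namespace InfTyping

/-! ### Substitution calculus and zero terms. -/

namespace Term

theorem upRen_comp (ρ ρ' : ℕ → ℕ) : upRen (fun n => ρ' (ρ n)) = fun n => upRen ρ' (upRen ρ n) := by
  funext n; cases n <;> rfl

theorem rename_rename (t : Term) (ρ ρ' : ℕ → ℕ) :
    rename ρ' (rename ρ t) = rename (fun n => ρ' (ρ n)) t := by
  induction t generalizing ρ ρ' with
  | var n => rfl
  | lam t ih => simp only [rename, ih, upRen_comp]
  | app t u iht ihu => simp only [rename, iht, ihu]

theorem upSubst_comp_upRen (ρ : ℕ → ℕ) (σ : ℕ → Term) :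
    (fun n => upSubst σ (upRen ρ n)) = upSubst (fun n => σ (ρ n)) := by
  funext n; cases n <;> rfl

theorem subst_rename (t : Term) (ρ : ℕ → ℕ) (σ : ℕ → Term) :
    subst σ (rename ρ t) = subst (fun n => σ (ρ n)) t := by
  induction t generalizing ρ σ with
  | var n => rfl
  | lam t ih => simp only [rename, subst, ih, upSubst_comp_upRen]
  | app t u iht ihu => simp only [rename, subst, iht, ihu]

theorem upSubst_rename (ρ : ℕ → ℕ) (σ : ℕ → Term) :
    upSubst (fun n => rename ρ (σ n)) = fun n => rename (upRen ρ) (upSubst σ n) := by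
  funext n
  cases n with
  | zero => rfl
  | succ n => simp only [upSubst, rename_rename]; rfl

theorem rename_subst (t : Term) (σ : ℕ → Term) (ρ : ℕ → ℕ) :
    rename ρ (subst σ t) = subst (fun n => rename ρ (σ n)) t := by
  induction t generalizing ρ σ with
  | var n => rfl
  | lam t ih => simp only [rename, subst, ih, upSubst_rename]
  | app t u iht ihu => simp only [rename, subst, iht, ihu]

theorem upSubst_subst (σ τ : ℕ → Term) :
    upSubst (fun n => subst τ (σ n)) = fun n => subst (upSubst τ) (upSubst σ n) := by
  funext n
  cases n with
  | zero => rfl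
  | succ n => simp only [upSubst, rename_subst, subst_rename]

theorem subst_subst (t : Term) (σ τ : ℕ → Term) :
    subst τ (subst σ t) = subst (fun n => subst τ (σ n)) t := by
  induction t generalizing σ τ with
  | var n => rfl
  | lam t ih => simp only [subst, ih, upSubst_subst]
  | app t u iht ihu => simp only [subst, iht, ihu]

theorem upSubst_var : upSubst var = var := by
  funext n; cases n <;> rfl

theorem subst_var (t : Term) : subst var t = t := by
  induction t with
  | var n => rfl
  | lam t ih => simp only [subst, upSubst_var, ih]
  | app t u iht ihu => simp only [subst, iht, ihu]

theorem subst_single_upSubst (u t : Term) (σ : ℕ → Term) :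
    subst (single u) (subst (upSubst σ) t) = subst (fun n => n.casesOn u σ) t := by
  rw [subst_subst]
  congr 1
  funext n
  cases n with
  | zero => rfl
  | succ n => exact (subst_rename (σ n) Nat.succ (single u)).trans (subst_var _)

/-- A zero term does not reduce to an abstraction. -/
theorem IsZeroTerm.not_betaStar_lam {t : Term} (ht : t.IsZeroTerm) (u : Term) :
    ¬ BetaStar t (lam u) := by
  intro h
  have h1 : ((1 : ℕ) : ℕ∞) ≤ order t := le_sSup ⟨1, rfl, u, h⟩
  rw [show order t = 0 from ht] at h1
  simp at h1

/-- Application to a list of arguments. -/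
def apps : Term → List Term → Term
  | t, [] => t
  | t, u :: l => apps (app t u) l

theorem Beta.apps {t t' : Term} (h : Beta t t') (l : List Term) :
    Beta (t.apps l) (t'.apps l) := by
  induction l generalizing t t' with
  | nil => exact h
  | cons u l ih => exact ih (h.appL u)

end Term

/-! ## Krivine's abstract machine -/

/-- Closures of Krivine's machine: a free variable, or a term with an environment, stamped with
the time of its creation. -/
inductive Closure : Type
  | free (x : ℕ) : Closure
  | susp (p : ℕ) (t : Term) (e : ℕ → Closure) : Closure

namespace Closure

/-- The term represented by a closure. -/
def readback : Closure → Term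
  | free x => Term.var x
  | susp _ t e => Term.subst (fun i => readback (e i)) t

/-- Extension of an environment. -/
def push (c : Closure) (e : ℕ → Closure) : ℕ → Closure
  | 0 => c
  | n + 1 => e n

end Closure

open Closure

/-- States of Krivine's machine. -/
structure State : Type where
  /-- The term under evaluation. -/
  code : Term
  /-- The values of its variables. -/
  env : ℕ → Closure
  /-- The arguments. -/
  stack : List Closure

namespace State

/-- The term represented by a state. -/
def readback (s : State) : Term :=
  (Term.subst (fun i => (s.env i).readback) s.code).apps (s.stack.map Closure.readback)

/-- The transition at time `n`. -/
def step (n : ℕ) : State → Option State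
  | ⟨Term.app t u, e, π⟩ => some ⟨t, e, susp n u e :: π⟩
  | ⟨Term.lam t, e, c :: π⟩ => some ⟨t, push c e, π⟩
  | ⟨Term.lam _, _, []⟩ => none
  | ⟨Term.var x, e, π⟩ =>
    match e x with
    | free _ => none
    | susp _ u e' => some ⟨u, e', π⟩

/-- Only binding an argument performs a head `β`-step; pushing an argument and fetching a closure
leave the represented term unchanged. -/
theorem betaStar_step {n : ℕ} {s s' : State} (h : s.step n = some s') :
    Term.BetaStar s.readback s'.readback := by
  obtain ⟨_ | b | ⟨t, u⟩, e, π⟩ := s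
  · rename_i x
    simp only [step] at h
    cases hx : e x with
    | free y => simp [hx] at h
    | susp p u e' =>
      simp only [hx, Option.some.injEq] at h
      subst h
      simp only [readback, Term.subst, hx, Closure.readback]
      exact .refl
  · cases π with
    | nil => simp [step] at h
    | cons c π =>
      simp only [step, Option.some.injEq] at h
      subst h
      refine .single ?_
      simp only [readback, Term.subst, List.map_cons, Term.apps]
      have := (Term.Beta.beta (Term.subst (Term.upSubst fun i => (e i).readback) b)
        c.readback).apps (π.map Closure.readback)
      rw [Term.subst_single_upSubst] at this
      convert this using 3
      funext i
      cases i <;> rfl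
  · simp only [step, Option.some.injEq] at h
    subst h
    exact .refl

end State

/-- The run of the machine on `t`. -/
def run (t : Term) : ℕ → Option State
  | 0 => some ⟨t, free, []⟩
  | n + 1 => (run t n).bind (State.step n)

variable {t : Term}

theorem run_app {n : ℕ} {u v : Term} {e : ℕ → Closure} {π : List Closure}
    (h : run t n = some ⟨Term.app u v, e, π⟩) : run t (n + 1) = some ⟨u, e, susp n v e :: π⟩ := by
  simp [run, h, State.step]

theorem run_lam {n : ℕ} {b : Term} {e : ℕ → Closure} {c : Closure} {π : List Closure}
    (h : run t n = some ⟨Term.lam b, e, c :: π⟩) : run t (n + 1) = some ⟨b, push c e, π⟩ := by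
  simp [run, h, State.step]

theorem run_var {n x p : ℕ} {v : Term} {e e' : ℕ → Closure} {π : List Closure}
    (h : run t n = some ⟨Term.var x, e, π⟩) (hx : e x = susp p v e') :
    run t (n + 1) = some ⟨v, e', π⟩ := by
  simp [run, h, State.step, hx]

/-- Case analysis on the last transition of a run. -/
theorem run_succ_cases {n : ℕ} {s : State} (h : run t (n + 1) = some s) :
    (∃ u v e π, run t n = some ⟨Term.app u v, e, π⟩ ∧ s = ⟨u, e, susp n v e :: π⟩) ∨
    (∃ b e c π, run t n = some ⟨Term.lam b, e, c :: π⟩ ∧ s = ⟨b, push c e, π⟩) ∨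
    (∃ x e p v e' π, run t n = some ⟨Term.var x, e, π⟩ ∧ e x = susp p v e' ∧ s = ⟨v, e', π⟩) := by
  simp only [run, Option.bind_eq_some_iff] at h
  obtain ⟨⟨_ | b | ⟨u, v⟩, e, π⟩, h1, h2⟩ := h
  · rename_i x
    simp only [State.step] at h2
    cases hx : e x with
    | free y => simp [hx] at h2
    | susp p v e' =>
      simp only [hx, Option.some.injEq] at h2
      exact .inr (.inr ⟨x, e, p, v, e', π, h1, hx, h2.symm⟩)
  · cases π with
    | nil => simp [State.step] at h2
    | cons c π =>
      simp only [State.step, Option.some.injEq] at h2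
      exact .inr (.inl ⟨b, e, c, π, h1, h2.symm⟩)
  · simp only [State.step, Option.some.injEq] at h2
    exact .inl ⟨u, v, e, π, h1, h2.symm⟩

theorem betaStar_run {n : ℕ} {s : State} (h : run t n = some s) :
    Term.BetaStar t s.readback := by
  induction n generalizing s with
  | zero =>
    simp only [run, Option.some.injEq] at h
    subst h
    have : State.readback ⟨t, free, []⟩ = t := Term.subst_var t
    rw [this]
    exact .refl
  | succ n ih =>
    simp only [run, Option.bind_eq_some_iff] at h
    obtain ⟨s', h1, h2⟩ := h
    exact (ih h1).trans (State.betaStar_step h2)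

/-- In the run on a zero term, an abstraction always meets an argument. -/
theorem run_lam_stack_ne_nil (ht : t.IsZeroTerm) {n : ℕ} {b : Term} {e : ℕ → Closure}
    {π : List Closure} (h : run t n = some ⟨Term.lam b, e, π⟩) : π ≠ [] := by
  rintro rfl
  -- With an empty stack the state reads back as an abstraction.
  exact ht.not_betaStar_lam _ (betaStar_run h)

/-! ### Creation and single binding of closures. -/

/-- The closure `c` was created by the run on `t` before time `n`. -/
def CreatedBefore (t : Term) (n : ℕ) (c : Closure) : Prop :=
  ∃ p u v e π, p < n ∧ c = susp p v e ∧ run t p = some ⟨Term.app u v, e, π⟩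

theorem CreatedBefore.mono {n m : ℕ} {c : Closure} (h : CreatedBefore t n c) (hnm : n ≤ m) :
    CreatedBefore t m c := by
  obtain ⟨p, u, v, e, π, hp, h⟩ := h
  exact ⟨p, u, v, e, π, hp.trans_le hnm, h⟩

theorem createdBefore_of_run {n : ℕ} {s : State} (h : run t n = some s) :
    (∀ x p v e, s.env x = susp p v e → CreatedBefore t n (susp p v e)) ∧
      ∀ c ∈ s.stack, CreatedBefore t n c := by
  induction n using Nat.strong_induction_on generalizing s with
  | _ n ih =>
  cases n with
  | zero =>
    simp only [run, Option.some.injEq] at h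
    subst h
    simp
  | succ n =>
    rcases run_succ_cases h with ⟨u, v, e, π, h1, rfl⟩ | ⟨b, e, c, π, h1, rfl⟩ |
      ⟨x, e, p, v, e', π, h1, hx, rfl⟩
    · obtain ⟨he, hs⟩ := ih n n.lt_succ_self h1
      refine ⟨fun x p v e hx => (he x p v e hx).mono n.le_succ, fun c hc => ?_⟩
      rcases List.mem_cons.1 hc with rfl | hc
      · exact ⟨n, u, v, e, π, n.lt_succ_self, rfl, h1⟩
      · exact (hs c hc).mono n.le_succ
    · obtain ⟨he, hs⟩ := ih n n.lt_succ_self h1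
      refine ⟨fun x p v e' hx => ?_, fun d hd => (hs d (List.mem_cons_of_mem _ hd)).mono n.le_succ⟩
      cases x with
      | zero =>
        have hx : c = susp p v e' := hx
        exact hx ▸ (hs c List.mem_cons_self).mono n.le_succ
      | succ x => exact (he x p v e' hx).mono n.le_succ
    · obtain ⟨he, hs⟩ := ih n n.lt_succ_self h1
      -- The restored environment is the one in force when the closure was created, hence the strong
      -- induction.
      obtain ⟨q, u', v', e'', π', hq, heq, hr⟩ := he x p v e' hx
      cases heq
      obtain ⟨he', -⟩ := ih p (hq.trans n.lt_succ_self) hr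
      exact ⟨fun y q v e hy => (he' y q v e hy).mono (hq.le.trans n.le_succ),
        fun c hc => (hs c hc).mono n.le_succ⟩

/-- The closure `c` is bound by an abstraction at time `n`. -/
def Binds (t : Term) (n : ℕ) (c : Closure) : Prop :=
  ∃ b e π, run t n = some ⟨Term.lam b, e, c :: π⟩

/-- Closures enter the stack only at creation, with a fresh stamp, and leave it only when bound. The
absence of duplicates ensures that no copy survives a binding. -/
theorem stack_nodup {n : ℕ} {s : State} (h : run t n = some s) :
    s.stack.Nodup ∧ ∀ m < n, ∀ c, Binds t m c → c ∉ s.stack := by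
  induction n generalizing s with
  | zero =>
    simp only [run, Option.some.injEq] at h
    subst h
    simp
  | succ n ih =>
    rcases run_succ_cases h with ⟨u, v, e, π, h1, rfl⟩ | ⟨b, e, c, π, h1, rfl⟩ |
      ⟨x, e, p, v, e', π, h1, hx, rfl⟩
    · obtain ⟨hn, hb⟩ := ih h1
      have new : ∀ m ≤ n, ¬ CreatedBefore t m (susp n v e) := by
        rintro m hm ⟨p, _, _, _, _, hp, heq, -⟩
        cases heq
        omega
      refine ⟨List.nodup_cons.2 ⟨fun hc => new n le_rfl ((createdBefore_of_run h1).2 _ hc), hn⟩,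
        fun m hm c hc hmem => ?_⟩
      have hmn : m < n := by
        refine lt_of_le_of_ne (Nat.lt_succ_iff.1 hm) ?_
        rintro rfl
        obtain ⟨_, _, _, h2⟩ := hc
        simp [h1] at h2
      rcases List.mem_cons.1 hmem with rfl | hmem
      · obtain ⟨_, _, _, h2⟩ := hc
        exact new m hmn.le ((createdBefore_of_run h2).2 _ List.mem_cons_self)
      · exact hb m hmn c hc hmem
    · obtain ⟨hn, hb⟩ := ih h1
      refine ⟨(List.nodup_cons.1 hn).2, fun m hm d hd hmem => ?_⟩
      rcases Nat.lt_succ_iff_lt_or_eq.1 hm with hm | rfl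
      · exact hb m hm d hd (List.mem_cons_of_mem _ hmem)
      · obtain ⟨_, _, _, h2⟩ := hd
        simp only [h1, Option.some.injEq, State.mk.injEq, List.cons.injEq] at h2
        obtain ⟨-, -, rfl, -⟩ := h2
        exact (List.nodup_cons.1 hn).1 hmem
    · obtain ⟨hn, hb⟩ := ih h1
      refine ⟨hn, fun m hm d hd hmem => ?_⟩
      rcases Nat.lt_succ_iff_lt_or_eq.1 hm with hm | rfl
      · exact hb m hm d hd hmem
      · obtain ⟨_, _, _, h2⟩ := hd
        simp [h1] at h2

/-- A closure is bound at most once. -/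
theorem Binds.unique {n m : ℕ} {c : Closure} (hn : Binds t n c) (hm : Binds t m c) : n = m := by
  have key : ∀ {n m : ℕ}, Binds t n c → Binds t m c → ¬ n < m := by
    rintro n m hn ⟨b, e, π, hm⟩ hlt
    exact (stack_nodup hm).2 n hlt c hn List.mem_cons_self
  exact le_antisymm (not_lt.1 (key hm hn)) (not_lt.1 (key hn hm))

/-! ## The forest of evaluation times -/

/-- `Edge t (n, x) (m, y)`: the term evaluated at time `m` is an immediate subterm of the one
evaluated at time `n`, in the same environment up to the bound variable, and the variable `y` of
the former is the variable `x` of the latter. -/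
inductive Edge (t : Term) : ℕ × ℕ → ℕ × ℕ → Prop
  | lam {n : ℕ} {b : Term} {e : ℕ → Closure} {c : Closure} {π : List Closure} (x : ℕ)
      (h : run t n = some ⟨Term.lam b, e, c :: π⟩) : Edge t (n, x) (n + 1, x + 1)
  | appL {n : ℕ} {u v : Term} {e : ℕ → Closure} {π : List Closure} (x : ℕ)
      (h : run t n = some ⟨Term.app u v, e, π⟩) : Edge t (n, x) (n + 1, x)
  | appR {n : ℕ} {u v : Term} {e : ℕ → Closure} {π : List Closure} {m y : ℕ} {e' : ℕ → Closure}
      {π' : List Closure} (x : ℕ) (h : run t n = some ⟨Term.app u v, e, π⟩)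
      (h' : run t m = some ⟨Term.var y, e', π'⟩) (hy : e' y = susp n v e) :
      Edge t (n, x) (m + 1, x)

/-- The descendant relation of the forest. -/
abbrev Desc (t : Term) : ℕ × ℕ → ℕ × ℕ → Prop := Relation.ReflTransGen (Edge t)

/-- The preceding state determines the kind of edge; after a fetch, the stamp of the closure gives
the time of the parent. -/
theorem Edge.parent_unique {a a' b : ℕ × ℕ} (h : Edge t a b) (h' : Edge t a' b) : a = a' := by
  generalize hb : b = b' at h'
  cases h <;> cases h' <;> simp_all

theorem Edge.lt {a b : ℕ × ℕ} (h : Edge t a b) : a.1 < b.1 := by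
  cases h with
  | lam => exact Nat.lt_succ_self _
  | appL => exact Nat.lt_succ_self _
  | appR x h h' hy =>
    obtain ⟨p, _, _, _, _, hp, heq, -⟩ := (createdBefore_of_run h').1 _ _ _ _ hy
    cases heq
    exact hp.trans (Nat.lt_succ_self _)

theorem Desc.le {a b : ℕ × ℕ} (h : Desc t a b) : a.1 ≤ b.1 := by
  induction h with
  | refl => exact le_rfl
  | tail _ h ih => exact ih.trans h.lt.le

theorem Desc.eq_of_siblings {a b b' z : ℕ × ℕ} (hb : Edge t a b) (hb' : Edge t a b')
    (h : Desc t b z) (h' : Desc t b' z) : b = b' := by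
  have key : ∀ {b b' : ℕ × ℕ}, Edge t a b → Edge t a b' → Desc t b b' → b = b' := by
    intro b b' hb hb' h
    rcases Relation.ReflTransGen.cases_tail h with rfl | ⟨d, hd, hdb⟩
    · rfl
    · cases hdb.parent_unique hb'
      exact absurd (Desc.le hd) (not_le.2 hb.lt)
  -- Parents being unique, the ancestors of `z` form a chain.
  have total : Desc t b b' ∨ Desc t b' b := by
    induction h with
    | refl => exact .inr h'
    | tail hbz hz ih =>
      rcases Relation.ReflTransGen.cases_tail h' with rfl | ⟨d, hd, hdz⟩
      · exact .inl (hbz.tail hz)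
      · cases hdz.parent_unique hz
        exact ih hd
  exact total.elim (key hb hb') fun h => (key hb' hb h).symm

/-- Corresponding variables have the same value. -/
theorem Desc.env_eq {a b : ℕ × ℕ} (h : Desc t a b) {s s' : State} (hs : run t a.1 = some s)
    (hs' : run t b.1 = some s') : s'.env b.2 = s.env a.2 := by
  induction h generalizing s' with
  | refl =>
    rw [hs] at hs'
    cases hs'
    rfl
  | tail _ h ih =>
    cases h with
    | lam x h =>
      have := ih h
      rw [run_lam h] at hs'
      cases hs'
      exact this
    | appL x h =>
      have := ih h
      rw [run_app h] at hs'
      cases hs'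
      exact this
    | appR x h h' hy =>
      have := ih h
      rw [run_var h' hy] at hs'
      cases hs'
      exact this

/-- Every variable whose value was created by the run descends from a bound variable. -/
theorem exists_binds {m x p : ℕ} {v : Term} {e : ℕ → Closure} {s : State}
    (hs : run t m = some s) (hx : s.env x = susp p v e) :
    ∃ n, Binds t n (susp p v e) ∧ Desc t (n + 1, 0) (m, x) := by
  induction m using Nat.strong_induction_on generalizing x s with
  | _ m ih =>
  cases m with
  | zero =>
    simp only [run, Option.some.injEq] at hs
    subst hs
    cases hx
  | succ m =>
    rcases run_succ_cases hs with ⟨u, v, e, π, h1, rfl⟩ | ⟨b, e, c, π, h1, rfl⟩ |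
      ⟨y, e, q, w, e', π, h1, hy, rfl⟩
    · obtain ⟨n, hn, hd⟩ := ih m m.lt_succ_self h1 hx
      exact ⟨n, hn, hd.tail (.appL x h1)⟩
    · cases x with
      | zero =>
        cases (show c = _ from hx)
        exact ⟨m, ⟨_, _, _, h1⟩, .refl⟩
      | succ x =>
        obtain ⟨n, hn, hd⟩ := ih m m.lt_succ_self h1 hx
        exact ⟨n, hn, hd.tail (.lam x h1)⟩
    · obtain ⟨_, u', _, _, π', hq, heq, hr⟩ := (createdBefore_of_run h1).1 _ _ _ _ hy
      cases heq
      obtain ⟨n, hn, hd⟩ := ih q (hq.trans m.lt_succ_self) hr hx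
      exact ⟨n, hn, hd.tail (.appR x hr h1 hy)⟩

/-! ## Types and contexts extracted from the run -/

/-- At time `m`, a variable with value `c` is evaluated. -/
def Fetches (t : Term) (c : Closure) (m : ℕ) : Prop :=
  ∃ y e π, run t m = some ⟨Term.var y, e, π⟩ ∧ e y = c

/-- At time `m`, the variable `x` of the term evaluated at time `n` is evaluated. -/
def Occurs (t : Term) (n x m : ℕ) : Prop :=
  ∃ y e π, run t m = some ⟨Term.var y, e, π⟩ ∧ Desc t (n, x) (m, y)

/-- The stack at time `m`. -/
def stackAt (t : Term) (m : ℕ) : List Closure := ((run t m).map State.stack).getD []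

theorem stackAt_eq {m : ℕ} {r : Term} {e : ℕ → Closure} {π : List Closure}
    (h : run t m = some ⟨r, e, π⟩) : stackAt t m = π := by
  simp [stackAt, h]

open Classical in
/-- The labelling of the type of a stack: the stack `c₁ ⋯ cₙ` has type `F₁ → ⋯ → Fₙ → o`, where
`Fᵢ` collects the types of the stacks at the times when `cᵢ` is fetched. -/
noncomputable def stackLabel (t : Term) (o : O) : List ℕ → List Closure → Option (Node O)
  | [], [] => some (Node.var o)
  | [], _ :: _ => some Node.arrow
  | _ :: _, [] => none
  | k :: w, c :: π =>
    if k = 1 then stackLabel t o w π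
    -- Track `k` encodes time `k - 2`, tracks 0 and 1 not being available to arguments. The
    -- recursion is on the position, so the stack may grow.
    else if 2 ≤ k ∧ Fetches t c (k - 2) then stackLabel t o w (stackAt t (k - 2))
    else none

/-- The type of a stack. -/
noncomputable def stackType (t : Term) (o : O) (π : List Closure) : SType O where
  label w := stackLabel t o w π
  root := by cases π <;> simp [stackLabel]
  parent w k h := by
    induction w generalizing π with
    | nil =>
      cases π with
      | nil => simp [stackLabel] at h
      | cons c π =>
        refine ⟨by simp [stackLabel], ?_⟩
        by_contra hk
        obtain rfl : k = 0 := by omega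
        simp [stackLabel] at h
    | cons j w ih =>
      cases π with
      | nil => simp [stackLabel] at h
      | cons c π =>
        simp only [List.cons_append, stackLabel] at h ⊢
        split_ifs at h ⊢
        · exact ih π h
        · exact ih _ h
        · exact absurd rfl h
  target w h := by
    induction w generalizing π with
    | nil =>
      cases π with
      | nil => simp [stackLabel] at h
      | cons c π => cases π <;> simp [stackLabel]
    | cons j w ih =>
      cases π with
      | nil => simp [stackLabel] at h
      | cons c π =>
        simp only [List.cons_append, stackLabel] at h ⊢
        split_ifs at h ⊢
        · exact ih π h
        · exact ih _ h

open Classical in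
/-- The sequence type that collects the types of the stacks at a set of times. -/
noncomputable def seqOf (t : Term) (o : O) (P : ℕ → Prop) : SeqType O := fun k =>
  if P (k.1 - 2) then some (stackType t o (stackAt t (k.1 - 2))) else none

theorem seqOf_eq_some {o : O} {P : ℕ → Prop} {k : Track} {S : SType O} :
    seqOf t o P k = some S ↔ P (k.1 - 2) ∧ stackType t o (stackAt t (k.1 - 2)) = S := by
  simp [seqOf]

theorem seqOf_eq_none {o : O} {P : ℕ → Prop} {k : Track} :
    seqOf t o P k = none ↔ ¬ P (k.1 - 2) := by
  simp [seqOf]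

theorem stackType_nil (o : O) : stackType t o [] = SType.var o := by
  ext1
  funext w
  cases w <;> simp [stackType, stackLabel, SType.var]

theorem stackType_cons (o : O) (c : Closure) (π : List Closure) :
    stackType t o (c :: π) = SType.arrow (seqOf t o (Fetches t c)) (stackType t o π) := by
  ext1
  funext w
  cases w with
  | nil => rfl
  | cons k w =>
    simp only [stackType, stackLabel, SType.arrow, SType.arrowLabel, seqOf]
    by_cases h1 : k = 1
    · simp [h1]
    by_cases h2 : 2 ≤ k
    · by_cases h3 : Fetches t c (k - 2) <;> simp [h1, h2, h3]
    · simp [h1, h2]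

/-- The context of the term evaluated at time `n`. -/
noncomputable def ctxAt (t : Term) (o : O) (n : ℕ) : Ctx O := fun x => seqOf t o (Occurs t n x)

/-! ### Occurrences of variables, one equivalence per typing rule. -/

theorem occurs_var_iff {n x : ℕ} {e : ℕ → Closure} {π : List Closure}
    (h : run t n = some ⟨Term.var x, e, π⟩) (y m : ℕ) : Occurs t n y m ↔ y = x ∧ m = n := by
  constructor
  · rintro ⟨z, e', π', hm, hd⟩
    rcases Relation.ReflTransGen.cases_head hd with heq | ⟨d, hd, -⟩
    · cases heq
      rw [h] at hm
      cases hm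
      exact ⟨rfl, rfl⟩
    · cases hd <;> simp_all
  · rintro ⟨rfl, rfl⟩
    exact ⟨y, e, π, h, .refl⟩

theorem occurs_lam_iff {n : ℕ} {b : Term} {e : ℕ → Closure} {c : Closure} {π : List Closure}
    (h : run t n = some ⟨Term.lam b, e, c :: π⟩) (x m : ℕ) :
    Occurs t (n + 1) (x + 1) m ↔ Occurs t n x m := by
  constructor
  · rintro ⟨y, e', π', hm, hd⟩
    exact ⟨y, e', π', hm, .head (.lam x h) hd⟩
  · rintro ⟨y, e', π', hm, hd⟩
    refine ⟨y, e', π', hm, ?_⟩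
    rcases Relation.ReflTransGen.cases_head hd with heq | ⟨d, hd, hdm⟩
    · cases heq
      simp [h] at hm
    · cases hd with
      | lam => exact hdm
      | appL _ h' => simp [h] at h'
      | appR _ h' => simp [h] at h'

theorem occurs_bound_iff {n : ℕ} {b : Term} {e : ℕ → Closure} {c : Closure} {π : List Closure}
    (h : run t n = some ⟨Term.lam b, e, c :: π⟩) (m : ℕ) :
    Occurs t (n + 1) 0 m ↔ Fetches t c m := by
  constructor
  · rintro ⟨y, e', π', hm, hd⟩
    exact ⟨y, e', π', hm, hd.env_eq (run_lam h) hm⟩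
  · rintro ⟨y, e', π', hm, hy⟩
    -- Being on the stack, `c` is not a free variable, so its fetch descends from a binder, which
    -- must be the one at time `n`.
    obtain ⟨p, _, v, e₀, _, -, rfl, -⟩ := (createdBefore_of_run h).2 c List.mem_cons_self
    obtain ⟨n', hn', hd⟩ := exists_binds hm hy
    obtain rfl := hn'.unique ⟨b, e, π, h⟩
    exact ⟨y, e', π', hm, hd⟩

/-- The children of an application are its function and one copy of its argument per fetch, exactly
the premises of the rule (app). -/
theorem occurs_app_iff {n : ℕ} {u v : Term} {e : ℕ → Closure} {π : List Closure}
    (h : run t n = some ⟨Term.app u v, e, π⟩) (x m : ℕ) :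
    Occurs t n x m ↔
      Occurs t (n + 1) x m ∨ ∃ j, Fetches t (susp n v e) j ∧ Occurs t (j + 1) x m := by
  constructor
  · rintro ⟨y, e', π', hm, hd⟩
    rcases Relation.ReflTransGen.cases_head hd with heq | ⟨d, hd, hdm⟩
    · cases heq
      simp [h] at hm
    · cases hd with
      | lam _ h' => simp [h] at h'
      | appL => exact .inl ⟨y, e', π', hm, hdm⟩
      | appR _ h' hj hy =>
        rw [h] at h'
        cases h'
        exact .inr ⟨_, ⟨_, _, _, hj, hy⟩, y, e', π', hm, hdm⟩
  · rintro (⟨y, e', π', hm, hd⟩ | ⟨j, ⟨z, e'', π'', hj, hz⟩, y, e', π', hm, hd⟩)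
    · exact ⟨y, e', π', hm, .head (.appL x h) hd⟩
    · exact ⟨y, e', π', hm, .head (.appR x h hj hz) hd⟩

/-- The times at which a given variable of two siblings is evaluated are different. -/
theorem Occurs.eq_of_siblings {a n n' x m : ℕ} (hn : Edge t (a, x) (n, x))
    (hn' : Edge t (a, x) (n', x)) (h : Occurs t n x m) (h' : Occurs t n' x m) : n = n' := by
  obtain ⟨y, e, π, hm, hd⟩ := h
  obtain ⟨y', e', π', hm', hd'⟩ := h'
  rw [hm] at hm'
  cases hm'
  exact congrArg Prod.fst (Desc.eq_of_siblings hn hn' hd hd')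

/-- The terms evaluated in the run on a zero term are typable with the type of their stack. -/
theorem derivable_of_run (ht : t.IsZeroTerm) (o : O) {r : Term} {n : ℕ} {e : ℕ → Closure}
    {π : List Closure} (h : run t n = some ⟨r, e, π⟩) :
    Derivable (ctxAt t o n) r (stackType t o π) := by
  -- Induction on the term, not on time: an argument must be typed at every time its closure is
  -- entered.
  induction r generalizing n e π with
  | var x =>
    convert Derivable.ax x ⟨n + 2, by omega⟩ (stackType t o π)
    funext y k
    obtain ⟨k, hk⟩ := k
    obtain ⟨m, rfl⟩ : ∃ m, k = m + 2 := ⟨k - 2, by omega⟩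
    by_cases hy : y = x
    · by_cases hm : m = n
      · subst hy hm
        simp [ctxAt, seqOf, occurs_var_iff h, Ctx.single, SeqType.single, stackAt_eq h]
      · simp [ctxAt, seqOf, occurs_var_iff h, Ctx.single, SeqType.single, hy, hm]
    · simp [ctxAt, seqOf, occurs_var_iff h, Ctx.single, SeqType.empty, hy]
  | lam b ih =>
    obtain ⟨c, π, rfl⟩ := List.exists_cons_of_ne_nil (run_lam_stack_ne_nil ht h)
    rw [stackType_cons]
    refine .abs ?_
    convert ih (run_lam h)
    funext x
    cases x with
    | zero => exact congrArg (seqOf t o) (funext fun m => propext (occurs_bound_iff h m).symm)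
    | succ x => exact congrArg (seqOf t o) (funext fun m => propext (occurs_lam_iff h x m).symm)
  | app u v ihu ihv =>
    have hu := ihu (run_app h)
    rw [stackType_cons] at hu
    have fetch : ∀ k : (seqOf t o (Fetches t (susp n v e))).roots,
        Fetches t (susp n v e) (k.1.1 - 2) ∧ stackType t o (stackAt t (k.1.1 - 2)) =
          (seqOf t o (Fetches t (susp n v e))).get k :=
      fun k => seqOf_eq_some.1 (Option.some_get k.2).symm
    have child : ∀ (x : ℕ) (k : (seqOf t o (Fetches t (susp n v e))).roots),
        Edge t (n, x) (k.1.1 - 2 + 1, x) := by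
      intro x k
      obtain ⟨y, e', π', hm, hy⟩ := (fetch k).1
      exact .appR x h hm hy
    refine .app (fun k => ctxAt t o (k.1.1 - 2 + 1)) _ hu (fun k => ?_) ⟨?_, ?_⟩
    · obtain ⟨⟨y, e', π', hm, hy⟩, hS⟩ := fetch k
      rw [← hS, stackAt_eq hm]
      exact ihv (run_var hm hy)
    -- Were the function and a copy of the argument the same node, the fetch would happen at time
    -- `n`, when an application is evaluated.
    · have left : ∀ (k : (seqOf t o (Fetches t (susp n v e))).roots) (x m : ℕ),
          Occurs t (n + 1) x m → ¬ Occurs t (k.1.1 - 2 + 1) x m := by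
        intro k x m h1 h2
        have := Occurs.eq_of_siblings (.appL x h) (child x k) h1 h2
        obtain ⟨y, e', π', hm, -⟩ := (fetch k).1
        rw [← Nat.succ.inj this, h] at hm
        cases hm
      rintro (_ | i) (_ | j) hij x k
      · exact absurd rfl hij
      · simp only [Ctx.family, ctxAt, seqOf_eq_none]
        exact not_or_of_imp (left j x _) |>.elim .inl .inr
      · simp only [Ctx.family, ctxAt, seqOf_eq_none]
        exact (not_or_of_imp (left i x _)).symm
      · simp only [Ctx.family, ctxAt, seqOf_eq_none]
        by_contra! hc
        have := Occurs.eq_of_siblings (child x i) (child x j) hc.1 hc.2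
        refine hij (congrArg some (Subtype.ext (Subtype.ext ?_)))
        have := i.1.2
        have := j.1.2
        omega
    · intro x k S
      simp only [ctxAt, seqOf_eq_some, occurs_app_iff h]
      constructor
      · rintro ⟨h1 | ⟨j, hj, h1⟩, hS⟩
        · exact ⟨none, seqOf_eq_some.2 ⟨h1, hS⟩⟩
        -- A fetch at time `j` selects the premise on track `j + 2`.
        · exact ⟨some ⟨⟨j + 2, by omega⟩,
            Option.isSome_iff_exists.2 ⟨_, seqOf_eq_some.2 ⟨hj, rfl⟩⟩⟩,
            seqOf_eq_some.2 ⟨h1, hS⟩⟩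
      · rintro ⟨_ | i, hi⟩
        · obtain ⟨h1, hS⟩ := seqOf_eq_some.1 hi
          exact ⟨.inl h1, hS⟩
        · obtain ⟨h1, hS⟩ := seqOf_eq_some.1 hi
          exact ⟨.inr ⟨_, (fetch i).1, h1⟩, hS⟩

end InfTyping

theorem lemmal {O : Type*} (t : InfTyping.Term) (ht : t.IsZeroTerm) (o : O) :
    ∃ C : InfTyping.Ctx O, InfTyping.Derivable C t (InfTyping.SType.var o) := by
  refine ⟨InfTyping.ctxAt t o 0, ?_⟩
  rw [← InfTyping.stackType_nil (t := t)]
  exact InfTyping.derivable_of_run ht o rfl
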